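/- Let $G$ be a finite simple connected graph with $n$ vertices, $m$ edges and vertex degrees $d_i$. Let $r_{ij}$ be the resistance distance between $i$ and $j$, that is, the effective resistance between $i$ and $j$ in the electrical network obtained from $G$ by replacing each edge by a unit resistor. Let $$\mathcal K(G)=\tfrac12\sum_{i,j}r_{ij},\qquad \bar{\mathcal K}(G)=\tfrac12\sum_{i,j}(d_i+d_j)r_{ij},\qquad \hat{\mathcal K}(G)=\tfrac12\sum_{i,j}d_id_jr_{ij}$$ be the Kirchhoff index, the additive degree-Kirchhoff index and the multiplicative degree-Kirchhoff index of $G$. For an integer $q\ge 1$, let $R_q(G)$ be the graph obtained from $G$ by adding, for each edge $uv$ of $G$, $q$ new vertices, each adjacent exactly to $u$ and $v$ (all edges of $G$ are kept). Put $R_{q,0}(G)=G$ and $R_{q,k}(G)=R_q(R_{q,k-1}(G))$ for $k\ge1$. Then for all integers $q\ge1$ and $k\ge0$, $$\begin{aligned} \mathcal K(R_{q,k}(G))={}&\Big(\tfrac{2}{q+2}\Big)^k\mathcal K(G)\\ &+\Big[\Big(\tfrac{2(2q+1)^2}{q+2}\Big)^k-\Big(\tfrac{2}{q+2}\Big)^k\Big]\Big(\frac{\hat{\mathcal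 K}(G)}{16}-\frac{m^2(q+2)}{12(2q+1)}-\frac{mn}{24}+\frac{m(q-1)}{24(2q+1)}\Big)\\ &+\Big[\Big(\tfrac{2(2q+1)}{q+2}\Big)^k-\Big(\tfrac{2}{q+2}\Big)^k\Big]\Big(\frac{\bar{\mathcal K}(G)}{4}-\frac{\hat{\mathcal K}(G)}{8}-\frac{m^2(q+2)(2q-1)}{6(2q+1)(2q+5)}+\frac{m(2n(q-1)-q+4)}{12(2q+1)}-\frac{n(n-1)}{12}\Big)\\ &+\Big[(2q+1)^{2k}-\Big(\tfrac{2}{q+2}\Big)^k\Big]\frac{m^2(2q+3)^2}{8(2q+1)(2q+5)}\\ &-\Big[(2q+1)^{k}-\Big(\tfrac{2}{q+2}\Big)^k\Big]\Big(\frac{m(4q^2+12q+11)(m-2n)}{12(2q+1)(2q+5)}+\frac{m(4q^2+18q+23)}{12(2q+1)(2q+5)}\Big)\\ &+\Big[\Big(\tfrac{2}{q+2}\Big)^k-1\Big]\frac{(m-2n)(m-2n+2)}{24}. \end{aligned}$$ -/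

import Mathlib

universe u

namespace QTriangulation

/-- A finite simple graph, bundled with its vertex type. -/
structure FinGraph where
  V : Type u
  fintypeV : Fintype V
  graph : SimpleGraph V

/-! ### Resistance distances and Kirchhoff indices -/

open Classical in
/-- `φ` is an electric potential on the network of unit resistors along the edges of `G` when a
unit current enters at `i` and leaves at `j`: at each node `x` the net current flowing
out of `x` along the edges, which is given by Ohm's law, equals the external current fed into `x`
(for `i = j` there is no external current). -/
def IsUnitCurrentPotential {V : Type u} [Fintype V] (G : SimpleGraph V) (i j : V)
    (φ : V → ℝ) : Prop :=
  ∀ x : V, (∑ y : V, if G.Adj x y then φ x - φ y else 0) =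
    (if x = i then 1 else 0) - (if x = j then 1 else 0)

open Classical in
/-- The resistance distance `r_{ij}`: the potential difference between `i` and `j` when a unit
current flows from `i` to `j`. In a connected graph such a potential exists, and the difference
does not depend on its choice (see below). If there is no such potential, the value is `0`. -/
noncomputable def resistanceDist {V : Type u} [Fintype V] (G : SimpleGraph V) (i j : V) : ℝ :=
  if h : ∃ φ : V → ℝ, IsUnitCurrentPotential G i j φ then h.choose i - h.choose j else 0

/-- The Kirchhoff index: the sum of the resistance distances over all unordered pairs. -/
noncomputable def kirchhoffIndex {V : Type u} [Fintype V] (G : SimpleGraph V) : ℝ :=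
  (1 / 2) * ∑ i : V, ∑ j : V, resistanceDist G i j

open Classical in
/-- The additive degree-Kirchhoff index. -/
noncomputable def additiveDegreeKirchhoffIndex {V : Type u} [Fintype V] (G : SimpleGraph V) : ℝ :=
  (1 / 2) * ∑ i : V, ∑ j : V, ((G.degree i : ℝ) + (G.degree j : ℝ)) * resistanceDist G i j

open Classical in
/-- The multiplicative degree-Kirchhoff index. -/
noncomputable def multiplicativeDegreeKirchhoffIndex {V : Type u} [Fintype V]
    (G : SimpleGraph V) : ℝ :=
  (1 / 2) * ∑ i : V, ∑ j : V, ((G.degree i : ℝ) * (G.degree j : ℝ)) * resistanceDist G i j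

/-! ### Triangulation -/

/-- The vertices of the `q`-triangulation: the old vertices, and `q` new ones for each edge. -/
abbrev TriVertex {V : Type u} (G : SimpleGraph V) (q : ℕ) : Type u :=
  V ⊕ (G.edgeSet × Fin q)

/-- Adjacency in the `q`-triangulation: old vertices are adjacent as before, and each of the `q`
new vertices that belong to the edge `uv` is adjacent to exactly `u` and `v`. -/
def triAdj {V : Type u} (G : SimpleGraph V) (q : ℕ) : TriVertex G q → TriVertex G q → Prop
  | Sum.inl u, Sum.inl v => G.Adj u v
  | Sum.inl u, Sum.inr (e, _) => u ∈ (e : Sym2 V)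
  | Sum.inr (e, _), Sum.inl v => v ∈ (e : Sym2 V)
  | Sum.inr _, Sum.inr _ => False

/-- The `q`-triangulation graph `R_q(G)`. -/
def triangulation {V : Type u} (G : SimpleGraph V) (q : ℕ) : SimpleGraph (TriVertex G q) where
  Adj := triAdj G q
  symm := ⟨by
    rintro (u | ⟨e, a⟩) (v | ⟨f, b⟩) h
    · exact G.adj_symm h
    · exact h
    · exact h
    · exact h⟩
  loopless := ⟨by
    rintro (u | ⟨e, a⟩) h
    · exact G.loopless.irrefl u h
    · exact h⟩

open Classical in
/-- The `q`-triangulation as an operation on finite graphs. -/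
noncomputable def FinGraph.tri (q : ℕ) (H : FinGraph.{u}) : FinGraph.{u} :=
  letI := H.fintypeV
  { V := TriVertex H.graph q
    fintypeV := inferInstance
    graph := triangulation H.graph q }

/-- The iterated `q`-triangulation graph `R_{q,k}(G)`. -/
noncomputable def iteratedTri {V : Type u} [Fintype V] (G : SimpleGraph V) (q : ℕ) :
    ℕ → FinGraph.{u}
  | 0 => ⟨V, inferInstance, G⟩
  | k + 1 => (iteratedTri G q k).tri q

/-- The Kirchhoff index of a bundled finite graph. -/
noncomputable def FinGraph.kirchhoffIndex (H : FinGraph.{u}) : ℝ :=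
  letI := H.fintypeV
  QTriangulation.kirchhoffIndex H.graph

/-! ### The resistance distance is well defined in a connected graph -/

open Classical in
theorem sum_adj_eq_lapMatrix {V : Type u} [Fintype V] (G : SimpleGraph V) (φ : V → ℝ) (x : V) :
    (∑ y : V, if G.Adj x y then φ x - φ y else 0) = (G.lapMatrix ℝ).mulVec φ x := by
  rw [SimpleGraph.lapMatrix_mulVec_apply, ← Finset.sum_filter, Finset.sum_sub_distrib,
    ← SimpleGraph.neighborFinset_eq_filter]
  simp

open Classical in
theorem eq_of_lapMatrix_mulVec_eq_zero {V : Type u} [Fintype V] {G : SimpleGraph V}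
    (hG : G.Connected) {φ : V → ℝ} (h : (G.lapMatrix ℝ).mulVec φ = 0)
    (i j : V) : φ i = φ j :=
  (G.lapMatrix_mulVec_eq_zero_iff_forall_reachable.1 h) i j (hG.preconnected i j)

open Classical in
theorem sum_lapMatrix_mulVec {V : Type u} [Fintype V] (G : SimpleGraph V) (φ : V → ℝ) :
    ∑ x, (G.lapMatrix ℝ).mulVec φ x = 0 := by
  have h : (fun _ : V => (1 : ℝ)) ⬝ᵥ (G.lapMatrix ℝ).mulVec φ = 0 := by
    rw [Matrix.dotProduct_mulVec, ← Matrix.mulVec_transpose, (SimpleGraph.isSymm_lapMatrix (R := ℝ) (G := G)).eq,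
      SimpleGraph.lapMatrix_mulVec_const_eq_zero]
    simp
  simpa [dotProduct] using h

theorem exists_isUnitCurrentPotential {V : Type u} [Fintype V] {G : SimpleGraph V}
    (hG : G.Connected) (i j : V) : ∃ φ : V → ℝ, IsUnitCurrentPotential G i j φ := by
  classical
  let T : (V → ℝ) →ₗ[ℝ] (V → ℝ) := (G.lapMatrix ℝ).mulVecLin +
    LinearMap.pi (fun _ => ∑ y : V, LinearMap.proj y)
  have hT : ∀ φ x, T φ x = (G.lapMatrix ℝ).mulVec φ x + ∑ y, φ y := by
    intro φ x
    simp [T]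
  have hcard : (Fintype.card V : ℝ) ≠ 0 := by
    have := hG.nonempty
    exact_mod_cast Fintype.card_ne_zero
  have hsum : ∀ φ, ∑ x, T φ x = 0 → ∑ y, φ y = 0 := by
    intro φ h
    simp only [hT, Finset.sum_add_distrib, sum_lapMatrix_mulVec, zero_add, Finset.sum_const,
      Finset.card_univ, nsmul_eq_mul] at h
    exact (mul_eq_zero.1 h).resolve_left hcard
  have hinj : Function.Injective T := by
    rw [← LinearMap.ker_eq_bot, LinearMap.ker_eq_bot']
    intro φ h
    have h0 := hsum φ (by simp [h])
    have hL : (G.lapMatrix ℝ).mulVec φ = 0 := by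
      funext x
      have := hT φ x
      simpa [h, h0] using this.symm
    funext x
    have hc : ∑ y, φ y = Fintype.card V * φ x := by
      rw [Finset.sum_congr rfl (fun y _ => eq_of_lapMatrix_mulVec_eq_zero hG hL y x)]
      simp
    rw [h0] at hc
    exact (mul_eq_zero.1 hc.symm).resolve_left hcard
  obtain ⟨φ, hφ⟩ := (LinearMap.injective_iff_surjective.1 hinj)
    (fun x => (if x = i then 1 else 0) - (if x = j then 1 else 0))
  have h0 := hsum φ (by simp [hφ])
  refine ⟨φ, fun x => ?_⟩
  have := hT φ x
  rw [hφ, h0, add_zero] at this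
  convert this.symm using 1
  · exact (sum_adj_eq_lapMatrix G φ x)

theorem resistanceDist_eq {V : Type u} [Fintype V] {G : SimpleGraph V} (hG : G.Connected)
    {i j : V} {φ : V → ℝ} (hφ : IsUnitCurrentPotential G i j φ) :
    resistanceDist G i j = φ i - φ j := by
  classical
  have hex : ∃ ψ : V → ℝ, IsUnitCurrentPotential G i j ψ := ⟨φ, hφ⟩
  rw [resistanceDist, dif_pos hex]
  have hψ := hex.choose_spec
  have h : (G.lapMatrix ℝ).mulVec (hex.choose - φ) = 0 := by
    funext x
    rw [Matrix.mulVec_sub, Pi.sub_apply, Pi.zero_apply, sub_eq_zero]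
    have h1 := hψ x
    rw [← hφ x] at h1
    convert h1 using 1
    · rw [sum_adj_eq_lapMatrix]
    · rw [sum_adj_eq_lapMatrix]
  have := eq_of_lapMatrix_mulVec_eq_zero hG (φ := hex.choose - φ) (by convert h) i j
  simp only [Pi.sub_apply] at this
  linarith

end QTriangulation

namespace QTriangulation

/-! A new vertex with no external current sits at the mean of the potentials of its two neighbours,
so the `q` new paths over an edge act as `q` parallel resistors of size 2, and every old conductance
is multiplied by `1 + q / 2`. Hence a Green function of `G` extends explicitly to one of `R_q(G)`
(`isGreen_triGreen`), and each resistance distance of `R_q(G)` is `2 / (q + 2)` times an average of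
those of `G`, plus corrections local to the new vertices (`resistanceDist_triangulation`).

Summing against weights moves the averages onto the weights (`sum_mul_avg`), and Foster's theorem
evaluates the corrections (`resistanceForm_triangulation`). Old degrees are multiplied by `q + 1`
and new degrees are 2, so all weights pull back to affine functions of the old degree, and the three
indices of `R_q(G)` are linear in those of `G` with an inhomogeneity polynomial in `n` and `m`.

This triangular recursion has eigenvalues `2 / (q + 2)`, `2 (2q + 1) / (q + 2)`, `2 (2q + 1) ^ 2 /
(q + 2)` from the indices, and `(2q + 1) ^ 2`, `2q + 1`, `1` from the inhomogeneity: `m` is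
multiplied by `2q + 1`, while `m - 2n` is invariant. `closedForm` is its solution. -/

open Classical in
/-- The net current flowing out of `x` when `φ` is the potential. -/
noncomputable def outflow {V : Type u} [Fintype V] (G : SimpleGraph V) (φ : V → ℝ) (x : V) : ℝ :=
  ∑ y : V, if G.Adj x y then φ x - φ y else 0

/-! ### Sums over edges and their ends -/

open Classical in
theorem sum_mem_edge {V : Type u} [Fintype V] (G : SimpleGraph V) [Fintype G.edgeSet]
    (F : Sym2 V → ℝ) (u : V) :
    ∑ e : G.edgeSet, (if u ∈ (e : Sym2 V) then F e else 0) =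
      ∑ v : V, if G.Adj u v then F s(u, v) else 0 := by
  rw [← Finset.sum_filter, ← Finset.sum_filter]
  symm
  refine Finset.sum_bij (fun v hv => ⟨s(u, v), (Finset.mem_filter.1 hv).2⟩) ?_ ?_ ?_ ?_
  · intro v hv
    simp
  · intro v hv w hw h
    exact Sym2.congr_right.1 (congrArg Subtype.val h)
  · rintro ⟨e, he⟩ h
    obtain ⟨v, rfl⟩ := (Finset.mem_filter.1 h).2
    exact ⟨v, by simpa using he, rfl⟩
  · intro v hv
    rfl

open Classical in
theorem sum_ends {V : Type u} [Fintype V] (g : V → ℝ) {u v : V} (h : u ≠ v) :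
    ∑ x : V, (if x ∈ s(u, v) then g x else 0) = g u + g v := by
  rw [← Finset.sum_filter, ← Finset.sum_pair h]
  congr 1
  ext x
  simp

open Classical in
theorem sum_ends_const {V : Type u} [Fintype V] {G : SimpleGraph V} (e : G.edgeSet) (c : ℝ) :
    ∑ x : V, (if x ∈ (e : Sym2 V) then c else 0) = 2 * c := by
  obtain ⟨e, he⟩ := e
  induction e with
  | _ u v => rw [sum_ends (fun _ => c) (G.ne_of_adj he)]; ring

-- Double counting of incidences: each edge has two ends, and the edges at `u` correspond to its
-- neighbours.
open Classical in
theorem two_mul_sum_edge {V : Type u} [Fintype V] (G : SimpleGraph V) [Fintype G.edgeSet]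
    (F : Sym2 V → ℝ) :
    2 * ∑ e : G.edgeSet, F e = ∑ u : V, ∑ v : V, if G.Adj u v then F s(u, v) else 0 := by
  simp_rw [← sum_mem_edge]
  rw [Finset.sum_comm, Finset.mul_sum]
  exact Finset.sum_congr rfl fun e _ => (sum_ends_const e _).symm

open Classical in
theorem degree_eq_sum {V : Type u} [Fintype V] (G : SimpleGraph V) (u : V) :
    (G.degree u : ℝ) = ∑ v : V, if G.Adj u v then 1 else 0 := by
  rw [← Finset.sum_filter, ← SimpleGraph.neighborFinset_eq_filter]
  simp

open Classical in
theorem sum_degree_eq {V : Type u} [Fintype V] (G : SimpleGraph V) :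
    ∑ u : V, (G.degree u : ℝ) = 2 * (G.edgeSet.ncard : ℝ) := by
  rw [Set.ncard_eq_toFinset_card']
  exact_mod_cast G.sum_degrees_eq_twice_card_edges

/-! ### Green functions and Foster's theorem -/

open Classical in
/-- `P i` is, up to the common external current `κ`, the potential of a unit current fed
into `i`. -/
def IsGreen {V : Type u} [Fintype V] (G : SimpleGraph V) (κ : V → ℝ) (P : V → V → ℝ) : Prop :=
  ∀ i x, outflow G (P i) x = (if x = i then 1 else 0) + κ x

theorem outflow_sub {V : Type u} [Fintype V] (G : SimpleGraph V) (φ ψ : V → ℝ) (x : V) :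
    outflow G (fun y => φ y - ψ y) x = outflow G φ x - outflow G ψ x := by
  unfold outflow
  rw [← Finset.sum_sub_distrib]
  refine Finset.sum_congr rfl fun y _ => ?_
  split_ifs <;> ring

theorem outflow_const_mul {V : Type u} [Fintype V] (G : SimpleGraph V) (c : ℝ) (φ : V → ℝ)
    (x : V) : outflow G (fun y => c * φ y) x = c * outflow G φ x := by
  unfold outflow
  rw [Finset.mul_sum]
  refine Finset.sum_congr rfl fun y _ => ?_
  split_ifs <;> ring

theorem sum_outflow {V : Type u} [Fintype V] (G : SimpleGraph V) (φ : V → ℝ) :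
    ∑ x, outflow G φ x = 0 := by
  classical
  rw [← sum_lapMatrix_mulVec G φ]
  exact Finset.sum_congr rfl fun x _ => by rw [← sum_adj_eq_lapMatrix]; rfl

open Classical in
theorem IsGreen.isUnitCurrentPotential {V : Type u} [Fintype V] {G : SimpleGraph V} {κ : V → ℝ}
    {P : V → V → ℝ} (hP : IsGreen G κ P) (i j : V) :
    IsUnitCurrentPotential G i j (fun x => P i x - P j x) := by
  intro x
  have h : outflow G (fun y => P i y - P j y) x =
      (if x = i then 1 else 0) - (if x = j then 1 else 0) := by
    rw [outflow_sub, hP, hP]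
    ring
  exact h

/-- Every unit current is drawn off at one fixed vertex `w`, which makes the external current `κ`
independent of the source. -/
theorem exists_isGreen {V : Type u} [Fintype V] {G : SimpleGraph V} (hG : G.Connected) :
    ∃ κ P, IsGreen G κ P := by
  classical
  obtain ⟨w⟩ := hG.nonempty
  choose P hP using fun i => exists_isUnitCurrentPotential hG i w
  refine ⟨fun x => -if x = w then 1 else 0, P, fun i x => ?_⟩
  have h : outflow G (P i) x = _ := hP i x
  rw [h, sub_eq_add_neg]

/-- The common current `κ` cancels in `P i - P j`. Symmetry of `P` is not assumed, so both mixed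
terms appear. -/
theorem IsGreen.resistanceDist_eq {V : Type u} [Fintype V] {G : SimpleGraph V}
    (hG : G.Connected) {κ : V → ℝ} {P : V → V → ℝ} (hP : IsGreen G κ P) (i j : V) :
    resistanceDist G i j = P i i + P j j - P i j - P j i := by
  rw [QTriangulation.resistanceDist_eq hG (hP.isUnitCurrentPotential i j)]
  ring

theorem resistanceDist_comm {V : Type u} [Fintype V] {G : SimpleGraph V} (hG : G.Connected)
    (i j : V) : resistanceDist G i j = resistanceDist G j i := by
  obtain ⟨κ, P, hP⟩ := exists_isGreen hG
  rw [hP.resistanceDist_eq hG, hP.resistanceDist_eq hG]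
  ring

open Classical in
/-- Foster's theorem, summed over ordered pairs of adjacent vertices. -/
theorem sum_adj_resistanceDist {V : Type u} [Fintype V] {G : SimpleGraph V}
    (hG : G.Connected) :
    ∑ u : V, ∑ v : V, (if G.Adj u v then resistanceDist G u v else 0) =
      2 * ((Fintype.card V : ℝ) - 1) := by
  obtain ⟨κ, P, hP⟩ := exists_isGreen hG
  obtain ⟨w⟩ := hG.nonempty
  -- The outflow of `P u` at `u` is `1 + κ u`, and `κ` has total `-1` because the outflows of any
  -- potential sum to zero.
  have hdiag : ∑ u, outflow G (P u) u = (Fintype.card V : ℝ) - 1 := by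
    have hκ := sum_outflow G (P w)
    simp_rw [hP w, Finset.sum_add_distrib] at hκ
    simp_rw [fun u => hP u u, Finset.sum_add_distrib]
    simp at hκ ⊢
    linarith
  have hsplit : ∀ u v, (if G.Adj u v then resistanceDist G u v else 0) =
      (if G.Adj u v then P u u - P u v else 0) + (if G.Adj v u then P v v - P v u else 0) := by
    intro u v
    rw [G.adj_comm v u, hP.resistanceDist_eq hG]
    split_ifs <;> ring
  simp_rw [hsplit, Finset.sum_add_distrib]
  rw [Finset.sum_comm (f := fun u v => if G.Adj v u then P v v - P v u else 0)]
  change ∑ u, outflow G (P u) u + ∑ u, outflow G (P u) u = _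
  rw [hdiag]
  ring

/-! ### Averaging over the ends of an edge -/

open Classical in
/-- The sum of a function over the vertices of `e`. -/
noncomputable def endSum {V : Type u} [Fintype V] (g : V → ℝ) (e : Sym2 V) : ℝ :=
  ∑ x : V, if x ∈ e then g x else 0

theorem endSum_mk {V : Type u} [Fintype V] (g : V → ℝ) {u v : V} (h : u ≠ v) :
    endSum g s(u, v) = g u + g v :=
  sum_ends g h

/-- The extension of a function on the old vertices by its mean over the two ends of each edge. -/
noncomputable def avg {V : Type u} [Fintype V] (G : SimpleGraph V) (q : ℕ) (g : V → ℝ) :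
    TriVertex G q → ℝ
  | Sum.inl u => g u
  | Sum.inr (e, _) => (1 / 2) * endSum g e

theorem avg_inl {V : Type u} [Fintype V] (G : SimpleGraph V) (q : ℕ) (g : V → ℝ) (u : V) :
    avg G q g (Sum.inl u) = g u := rfl

theorem avg_inr {V : Type u} [Fintype V] (G : SimpleGraph V) (q : ℕ) (g : V → ℝ)
    (e : G.edgeSet) (a : Fin q) : avg G q g (Sum.inr (e, a)) = (1 / 2) * endSum g e := rfl

theorem avg_inr_mk {V : Type u} [Fintype V] {G : SimpleGraph V} {q : ℕ} (g : V → ℝ) {u v : V}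
    (h : s(u, v) ∈ G.edgeSet) (a : Fin q) :
    avg G q g (Sum.inr (⟨s(u, v), h⟩, a)) = (g u + g v) / 2 := by
  rw [avg_inr, endSum_mk g (G.ne_of_adj h)]
  ring

open Classical in
theorem sum_triVertex {V : Type u} [Fintype V] (G : SimpleGraph V) (q : ℕ)
    [Fintype (TriVertex G q)] (f : TriVertex G q → ℝ) :
    ∑ x, f x = ∑ u : V, f (Sum.inl u) + ∑ e : G.edgeSet, ∑ a : Fin q, f (Sum.inr (e, a)) := by
  rw [← Fintype.sum_prod_type', ← Fintype.sum_sum_type]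
  -- The `Fintype` instance on `TriVertex G q` is arbitrary, to match the one carried by the
  -- iterates; only instances differ here.
  congr!

theorem card_triVertex {V : Type u} [Fintype V] (G : SimpleGraph V) (q : ℕ)
    [Fintype (TriVertex G q)] :
    Fintype.card (TriVertex G q) = Fintype.card V + q * G.edgeSet.ncard := by
  classical
  rw [← Nat.card_eq_fintype_card, Nat.card_sum, Nat.card_prod, Nat.card_fin,
    Nat.card_eq_fintype_card, Nat.card_coe_set_eq, mul_comm]

open Classical in
/-- Averaging is adjoint to distributing the weight of each new vertex to the ends of its edge. -/
theorem sum_mul_avg {V : Type u} [Fintype V] (G : SimpleGraph V) (q : ℕ)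
    [Fintype (TriVertex G q)] (a : V → ℝ) (β : ℝ) (g : V → ℝ) :
    ∑ x : TriVertex G q, Sum.elim a (fun _ => β) x * avg G q g x =
      ∑ u : V, (a u + β * q * G.degree u / 2) * g u := by
  have hsum : ∑ e : G.edgeSet, endSum g e = ∑ u : V, (G.degree u : ℝ) * g u := by
    simp only [endSum]
    rw [Finset.sum_comm]
    refine Finset.sum_congr rfl fun u _ => ?_
    rw [sum_mem_edge G (fun _ => g u) u, degree_eq_sum, Finset.sum_mul]
    refine Finset.sum_congr rfl fun v _ => ?_
    split_ifs <;> ring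
  rw [sum_triVertex]
  simp only [Sum.elim_inl, Sum.elim_inr, avg_inl, avg_inr, Finset.sum_const, Finset.card_univ,
    Fintype.card_fin, nsmul_eq_mul]
  simp_rw [← Finset.mul_sum]
  rw [hsum, Finset.mul_sum, Finset.mul_sum, Finset.mul_sum, ← Finset.sum_add_distrib]
  exact Finset.sum_congr rfl fun u _ => by ring

/-! ### The Green function and the resistance distance of the triangulation -/

/-- A new vertex has just the two ends of its edge as neighbours, so it is balanced exactly at their
mean, which is the value given by `avg`. -/
theorem outflow_triangulation_inr {V : Type u} [Fintype V] (G : SimpleGraph V) (q : ℕ)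
    [Fintype (TriVertex G q)] (φ : TriVertex G q → ℝ) (e : G.edgeSet) (a : Fin q) :
    outflow (triangulation G q) φ (Sum.inr (e, a)) =
      2 * φ (Sum.inr (e, a)) - endSum (fun u => φ (Sum.inl u)) e := by
  classical
  rw [outflow, sum_triVertex]
  have h1 : ∀ (f : G.edgeSet) (b : Fin q),
      ¬ (triangulation G q).Adj (Sum.inr (e, a)) (Sum.inr (f, b)) := fun _ _ h => h
  have h2 : ∀ u : V, (triangulation G q).Adj (Sum.inr (e, a)) (Sum.inl u) ↔ u ∈ (e : Sym2 V) :=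
    fun _ => Iff.rfl
  simp only [h1, h2, if_false, Finset.sum_const_zero, add_zero]
  rw [← sum_ends_const e, endSum, ← Finset.sum_sub_distrib]
  refine Finset.sum_congr rfl fun y _ => ?_
  split_ifs <;> ring

open Classical in
/-- Balancing the new vertices scales the currents between old vertices by `1 + q / 2`, and half
of an external current fed into a new vertex reaches each of its neighbours. -/
theorem outflow_triangulation_inl {V : Type u} [Fintype V] (G : SimpleGraph V) (q : ℕ)
    [Fintype (TriVertex G q)] (g : V → ℝ) (c : G.edgeSet → Fin q → ℝ) (u : V) :
    outflow (triangulation G q)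
        (fun x => avg G q g x + Sum.elim (fun _ => 0) (fun y => c y.1 y.2) x) (Sum.inl u) =
      (1 + q / 2) * outflow G g u -
        ∑ e : G.edgeSet, ∑ a : Fin q, if u ∈ (e : Sym2 V) then c e a else 0 := by
  have h1 : ∀ (f : G.edgeSet) (b : Fin q),
      (triangulation G q).Adj (Sum.inl u) (Sum.inr (f, b)) ↔ u ∈ (f : Sym2 V) :=
    fun _ _ => Iff.rfl
  have h2 : ∀ v : V, (triangulation G q).Adj (Sum.inl u) (Sum.inl v) ↔ G.Adj u v :=
    fun _ => Iff.rfl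
  -- From `u` to the midpoint value the potential drops by half the drop along the edge, so each new
  -- vertex carries half the current of its edge.
  have h3 : ∑ e : G.edgeSet, (if u ∈ (e : Sym2 V) then g u - 1 / 2 * endSum g e else 0) =
      1 / 2 * outflow G g u := by
    rw [sum_mem_edge G (fun e => g u - 1 / 2 * endSum g e), outflow, Finset.mul_sum]
    refine Finset.sum_congr rfl fun v _ => ?_
    split_ifs with h
    · rw [endSum_mk g (G.ne_of_adj h)]
      ring
    · simp
  have h4 : ∀ (e : G.edgeSet) (a : Fin q),
      (if u ∈ (e : Sym2 V) then g u - (1 / 2 * endSum g e + c e a) else 0) =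
      (if u ∈ (e : Sym2 V) then g u - 1 / 2 * endSum g e else 0) -
        if u ∈ (e : Sym2 V) then c e a else 0 := by
    intro e a
    split_ifs <;> ring
  rw [outflow, sum_triVertex]
  simp only [h1, h2, avg_inl, avg_inr, Sum.elim_inl, Sum.elim_inr, add_zero, h4,
    Finset.sum_sub_distrib, Finset.sum_const, Finset.card_univ, Fintype.card_fin, nsmul_eq_mul]
  rw [← Finset.mul_sum, h3]
  change outflow G g u + _ = _
  ring

/-- Outflow is linear in the potential, so it commutes with averaging over the source. -/
theorem outflow_avg {V : Type u} [Fintype V] (G : SimpleGraph V) (q : ℕ) (P : V → V → ℝ)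
    (x : TriVertex G q) (u : V) :
    outflow G (fun j => avg G q (fun i => P i j) x) u =
      avg G q (fun i => outflow G (P i) u) x := by
  rcases x with w | ⟨⟨e, he⟩, a⟩
  · rfl
  · induction e with
    | _ v w =>
      simp only [avg_inr_mk, outflow, ← Finset.sum_add_distrib, Finset.sum_div]
      refine Finset.sum_congr rfl fun y _ => ?_
      split_ifs <;> ring

open Classical in
/-- The Green function of the triangulation that is built from one of the graph. -/
noncomputable def triGreen {V : Type u} [Fintype V] (G : SimpleGraph V) (q : ℕ) (P : V → V → ℝ)
    (x y : TriVertex G q) : ℝ :=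
  avg G q (fun j => 2 / ((q : ℝ) + 2) * avg G q (fun i => P i j) x) y +
    Sum.elim (fun _ => 0) (fun z => if Sum.inr z = x then 1 / 2 else 0) y

/-- The factor `2 / (q + 2)` undoes the conductance factor `1 + q / 2`. For a new source `x`,
raising its potential by `1 / 2` above the mean sends `1 / 2` to each end, which is just what the
averaged source requires there. No extra external current is needed at new vertices, so `κ` extends
by zero. -/
theorem isGreen_triGreen {V : Type u} [Fintype V] {G : SimpleGraph V} (q : ℕ)
    [Fintype (TriVertex G q)] {κ : V → ℝ} {P : V → V → ℝ} (hP : IsGreen G κ P) :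
    IsGreen (triangulation G q) (Sum.elim κ fun _ => 0) (triGreen G q P) := by
  classical
  have hq : (q : ℝ) + 2 ≠ 0 := by positivity
  intro x z
  rcases z with u | ⟨e, a⟩
  · refine (outflow_triangulation_inl G q _
      (fun e a => if Sum.inr (e, a) = x then 1 / 2 else 0) u).trans ?_
    rw [outflow_const_mul, outflow_avg]
    simp only [fun i => hP i u]
    rcases x with w | ⟨⟨f, hf⟩, b⟩
    · simp [avg_inl]
      field_simp
      ring
    · have hs : ∀ (e : G.edgeSet), ∑ a : Fin q, (if u ∈ (e : Sym2 V) then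
          if (Sum.inr (e, a) : TriVertex G q) = Sum.inr (⟨f, hf⟩, b) then (1 / 2 : ℝ) else 0
          else 0) = if e = ⟨f, hf⟩ then if u ∈ f then 1 / 2 else 0 else 0 := by
        rintro ⟨e, he⟩
        by_cases h : e = f
        · subst h
          simp
        · simp [h]
      rw [Finset.sum_congr rfl fun e _ => hs e, Finset.sum_ite_eq' Finset.univ]
      induction f with
      | _ v w =>
        have hvw : v ≠ w := G.ne_of_adj hf
        rw [avg_inr_mk]
        have hm : (if u ∈ s(v, w) then (1 / 2 : ℝ) else 0) =
            ((if u = v then 1 else 0) + (if u = w then 1 else 0)) / 2 := by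
          rcases eq_or_ne u v with rfl | h
          · simp [hvw]
          · rcases eq_or_ne u w with rfl | h'
            · simp [h]
            · simp [h, h']
        simp only [Finset.mem_univ, if_true, hm, Sum.elim_inl, reduceCtorEq, if_false]
        field_simp
        ring
  · rw [outflow_triangulation_inr]
    simp only [triGreen, avg_inl, avg_inr, Sum.elim_inl, Sum.elim_inr, add_zero]
    split_ifs <;> ring

theorem connected_triangulation {V : Type u} {G : SimpleGraph V} (hG : G.Connected) (q : ℕ) :
    (triangulation G q).Connected := by
  obtain ⟨w⟩ := hG.nonempty
  have hold : ∀ v : V, (triangulation G q).Reachable (Sum.inl w) (Sum.inl v) := fun v =>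
    (hG.preconnected w v).map (⟨Sum.inl, fun h => h⟩ : G →g triangulation G q)
  rw [SimpleGraph.connected_iff_exists_forall_reachable]
  refine ⟨Sum.inl w, ?_⟩
  rintro (v | ⟨⟨e, he⟩, a⟩)
  · exact hold v
  · induction e with
    | _ u v =>
      refine (hold u).trans (SimpleGraph.Adj.reachable ?_)
      exact Sym2.mem_mk_left u v

open Classical in
/-- The resistance distances of the triangulation. -/
theorem resistanceDist_triangulation {V : Type u} [Fintype V] {G : SimpleGraph V}
    (hG : G.Connected) (q : ℕ) [Fintype (TriVertex G q)] {rE : Sym2 V → ℝ}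
    (hrE : ∀ u v, rE s(u, v) = resistanceDist G u v) (x y : TriVertex G q) :
    resistanceDist (triangulation G q) x y =
      Sum.elim (fun _ => 0) (fun z => 1 / 2 - rE z.1 / (2 * (q + 2))) x +
      Sum.elim (fun _ => 0) (fun z => 1 / 2 - rE z.1 / (2 * (q + 2))) y +
      2 / ((q : ℝ) + 2) * avg G q (fun j => avg G q (fun i => resistanceDist G i j) x) y -
      Sum.elim (fun _ => 0) (fun z => if Sum.inr z = x then 1 else 0) y := by
  have hq : (q : ℝ) + 2 ≠ 0 := by positivity
  obtain ⟨κ, P, hP⟩ := exists_isGreen hG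
  rw [(isGreen_triGreen q hP).resistanceDist_eq (connected_triangulation hG q)]
  have hr := hP.resistanceDist_eq hG
  -- At a new vertex on `st`, the mean of `P s s` and `P t t` exceeds the double average of `P` by a
  -- quarter of the resistance between `s` and `t`. Times `2 / (q + 2)`, this is the correction `-rE
  -- / (2 (q + 2))`; the `1 / 2` is the raised diagonal of `triGreen`. For equal new vertices the
  -- mixed terms contain that raise twice, whence the final `-1`.
  simp only [triGreen]
  rcases x with u | ⟨⟨e, he⟩, a⟩ <;> rcases y with v | ⟨⟨f, hf⟩, b⟩
  · simp [avg_inl, hr]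
    ring
  · induction f with
    | _ s t =>
      simp only [avg_inl, avg_inr_mk, Sum.elim_inl, Sum.elim_inr, hr, hrE, reduceCtorEq, if_false,
        if_true]
      field_simp
      ring
  · induction e with
    | _ s t =>
      simp only [avg_inl, avg_inr_mk, Sum.elim_inl, Sum.elim_inr, hr, hrE, reduceCtorEq, if_false,
        if_true]
      field_simp
      ring
  · induction e with
    | _ s t =>
      induction f with
      | _ v w =>
        simp only [avg_inr_mk, Sum.elim_inr, hr, hrE, if_true]
        rcases eq_or_ne (Sum.inr (⟨s(s, t), he⟩, a) : TriVertex G q)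
          (Sum.inr (⟨s(v, w), hf⟩, b)) with h | h
        · simp only [if_pos h, if_pos h.symm]
          field_simp
          ring
        · simp only [if_neg h, if_neg h.symm]
          field_simp
          ring

/-! ### Weighted sums of resistance distances -/

/-- The sum of the resistance distances over ordered pairs, weighted by `a` and `b`. -/
noncomputable def resistanceForm {V : Type u} [Fintype V] (G : SimpleGraph V) (a b : V → ℝ) : ℝ :=
  ∑ i : V, ∑ j : V, a i * b j * resistanceDist G i j

theorem resistanceForm_comm {V : Type u} [Fintype V] {G : SimpleGraph V} (hG : G.Connected)
    (a b : V → ℝ) : resistanceForm G a b = resistanceForm G b a := by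
  unfold resistanceForm
  rw [Finset.sum_comm]
  refine Finset.sum_congr rfl fun i _ => Finset.sum_congr rfl fun j _ => ?_
  rw [resistanceDist_comm hG]
  ring

theorem resistanceForm_affine {V : Type u} [Fintype V] {G : SimpleGraph V} (hG : G.Connected)
    (c₁ c₂ d₁ d₂ : ℝ) (w : V → ℝ) :
    resistanceForm G (fun i => c₁ + d₁ * w i) (fun i => c₂ + d₂ * w i) =
      c₁ * c₂ * resistanceForm G (fun _ => 1) (fun _ => 1) +
      (c₁ * d₂ + d₁ * c₂) * resistanceForm G w (fun _ => 1) +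
      d₁ * d₂ * resistanceForm G w w := by
  have h : resistanceForm G (fun i => c₁ + d₁ * w i) (fun i => c₂ + d₂ * w i) =
      c₁ * c₂ * resistanceForm G (fun _ => 1) (fun _ => 1) +
      c₁ * d₂ * resistanceForm G (fun _ => 1) w +
      d₁ * c₂ * resistanceForm G w (fun _ => 1) +
      d₁ * d₂ * resistanceForm G w w := by
    simp only [resistanceForm, Finset.mul_sum, ← Finset.sum_add_distrib]
    exact Finset.sum_congr rfl fun i _ => Finset.sum_congr rfl fun j _ => by ring
  rw [h, resistanceForm_comm hG (fun _ => 1) w]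
  ring

theorem kirchhoffIndex_eq {V : Type u} [Fintype V] (G : SimpleGraph V) :
    kirchhoffIndex G = resistanceForm G (fun _ => 1) (fun _ => 1) / 2 := by
  simp only [kirchhoffIndex, resistanceForm, one_mul]
  ring

open Classical in
theorem additiveDegreeKirchhoffIndex_eq {V : Type u} [Fintype V] {G : SimpleGraph V}
    (hG : G.Connected) :
    additiveDegreeKirchhoffIndex G =
      resistanceForm G (fun i => (G.degree i : ℝ)) (fun _ => 1) := by
  have h : additiveDegreeKirchhoffIndex G =
      (1 / 2) * (resistanceForm G (fun i => (G.degree i : ℝ)) (fun _ => 1) +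
        resistanceForm G (fun _ => 1) (fun i => (G.degree i : ℝ))) := by
    simp only [additiveDegreeKirchhoffIndex, resistanceForm, ← Finset.sum_add_distrib]
    congr 1
    exact Finset.sum_congr rfl fun i _ => Finset.sum_congr rfl fun j _ => by ring
  rw [h, resistanceForm_comm hG (fun _ => 1)]
  ring

open Classical in
theorem multiplicativeDegreeKirchhoffIndex_eq {V : Type u} [Fintype V] (G : SimpleGraph V) :
    multiplicativeDegreeKirchhoffIndex G =
      resistanceForm G (fun i => (G.degree i : ℝ)) (fun i => (G.degree i : ℝ)) / 2 := by
  simp only [multiplicativeDegreeKirchhoffIndex, resistanceForm]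
  ring

theorem card_edgeSet {V : Type u} (G : SimpleGraph V) [Fintype G.edgeSet] :
    Fintype.card G.edgeSet = G.edgeSet.ncard := by
  rw [← Nat.card_eq_fintype_card, Nat.card_coe_set_eq]

theorem sum_elim_triVertex {V : Type u} [Fintype V] (G : SimpleGraph V) (q : ℕ)
    [Fintype (TriVertex G q)] (a : V → ℝ) (β : ℝ) :
    ∑ x : TriVertex G q, Sum.elim a (fun _ => β) x = ∑ u, a u + q * G.edgeSet.ncard * β := by
  classical
  rw [sum_triVertex]
  simp only [Sum.elim_inl, Sum.elim_inr, Finset.sum_const, Finset.card_univ, Fintype.card_fin,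
    nsmul_eq_mul, card_edgeSet]
  ring

-- This one bilinear formula yields all three indices: take each weight to be 1 or the degree. Each
-- new vertex hands half its weight to each end, adding `α * q * degree / 2` at an old vertex.
open Classical in
theorem resistanceForm_triangulation {V : Type u} [Fintype V] {G : SimpleGraph V}
    (hG : G.Connected) (q : ℕ) [Fintype (TriVertex G q)] (a b : V → ℝ) (α β : ℝ) :
    resistanceForm (triangulation G q) (Sum.elim a fun _ => α) (Sum.elim b fun _ => β) =
      2 / ((q : ℝ) + 2) * resistanceForm G (fun i => a i + α * q * G.degree i / 2)
        (fun i => b i + β * q * G.degree i / 2) +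
      q * ((G.edgeSet.ncard : ℝ) / 2 - ((Fintype.card V : ℝ) - 1) / (2 * (q + 2))) *
        (α * (∑ u, b u + q * G.edgeSet.ncard * β) + β * (∑ u, a u + q * G.edgeSet.ncard * α)) -
      q * G.edgeSet.ncard * α * β := by
  obtain ⟨rE, hrE⟩ : ∃ rE : Sym2 V → ℝ, ∀ u v, rE s(u, v) = resistanceDist G u v :=
    ⟨Sym2.lift ⟨resistanceDist G, resistanceDist_comm hG⟩, fun _ _ => rfl⟩
  set t : ℝ := 2 / ((q : ℝ) + 2) with ht
  set wa : TriVertex G q → ℝ := Sum.elim a fun _ => α with hwa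
  set wb : TriVertex G q → ℝ := Sum.elim b fun _ => β with hwb
  set h : TriVertex G q → ℝ :=
    Sum.elim (fun _ => 0) (fun z => 1 / 2 - rE z.1 / (2 * (q + 2))) with hh
  have hsumh : ∀ (c : V → ℝ) (γ : ℝ), ∑ x : TriVertex G q, Sum.elim c (fun _ => γ) x * h x =
      γ * (q * ((G.edgeSet.ncard : ℝ) / 2 - ((Fintype.card V : ℝ) - 1) / (2 * (q + 2)))) := by
    intro c γ
    -- Foster's theorem: the corrections at the new vertices depend on `G` only through `n` and `m`.
    have hF : ∑ e : G.edgeSet, rE e = (Fintype.card V : ℝ) - 1 := by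
      have h1 := two_mul_sum_edge G rE
      simp only [hrE, sum_adj_resistanceDist hG] at h1
      linarith
    rw [sum_triVertex]
    simp only [hh, Sum.elim_inl, Sum.elim_inr, mul_zero, Finset.sum_const_zero, zero_add,
      Finset.sum_const, Finset.card_univ, Fintype.card_fin, nsmul_eq_mul, ← Finset.mul_sum,
      Finset.sum_sub_distrib, ← Finset.sum_div, hF]
    rw [card_edgeSet]
    ring
  -- Adjointness of averaging is used twice, first in `y` and then in `x`.
  have hT : ∑ x, ∑ y, wa x * wb y *
      (t * avg G q (fun j => avg G q (fun i => resistanceDist G i j) x) y) =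
      t * resistanceForm G (fun i => a i + α * q * G.degree i / 2)
        (fun i => b i + β * q * G.degree i / 2) := by
    have h1 : ∀ x, ∑ y, wa x * wb y *
        (t * avg G q (fun j => avg G q (fun i => resistanceDist G i j) x) y) =
        t * ∑ j, (b j + β * q * G.degree j / 2) *
          (wa x * avg G q (fun i => resistanceDist G i j) x) := by
      intro x
      have := sum_mul_avg G q b β (fun j => avg G q (fun i => resistanceDist G i j) x)
      calc _ = t * wa x * ∑ y, wb y *
            avg G q (fun j => avg G q (fun i => resistanceDist G i j) x) y := by
            rw [Finset.mul_sum]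
            exact Finset.sum_congr rfl fun y _ => by ring
        _ = _ := by
            rw [hwb, this, mul_assoc, Finset.mul_sum]
            congr 1
            exact Finset.sum_congr rfl fun y _ => by ring
    simp_rw [h1, ← Finset.mul_sum]
    rw [Finset.sum_comm]
    simp_rw [← Finset.mul_sum, hwa, sum_mul_avg, resistanceForm]
    rw [Finset.sum_comm (s := Finset.univ (α := V))]
    congr 1
    refine Finset.sum_congr rfl fun j _ => ?_
    rw [Finset.mul_sum]
    exact Finset.sum_congr rfl fun i _ => by ring
  have hD : ∑ x, ∑ y, wa x * wb y *
      Sum.elim (fun _ => 0) (fun z => if (Sum.inr z : TriVertex G q) = x then 1 else 0) y =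
      q * G.edgeSet.ncard * α * β := by
    rw [Finset.sum_comm, sum_triVertex]
    simp [hwa, hwb, -Fintype.card_ofFinset]
    ring
  have hA : ∑ x, wa x = ∑ u, a u + q * G.edgeSet.ncard * α := sum_elim_triVertex G q a α
  have hB : ∑ x, wb x = ∑ u, b u + q * G.edgeSet.ncard * β := sum_elim_triVertex G q b β
  have h1 : ∑ x, ∑ y, wa x * wb y * h x = (∑ x, wa x * h x) * ∑ y, wb y := by
    rw [Finset.sum_mul_sum]
    exact Finset.sum_congr rfl fun i _ => Finset.sum_congr rfl fun j _ => by ring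
  have h2 : ∑ x, ∑ y, wa x * wb y * h y = (∑ x, wa x) * ∑ y, wb y * h y := by
    rw [Finset.sum_mul_sum]
    exact Finset.sum_congr rfl fun i _ => Finset.sum_congr rfl fun j _ => by ring
  rw [resistanceForm]
  have hr : ∀ x y, resistanceDist (triangulation G q) x y = h x + h y +
      t * avg G q (fun j => avg G q (fun i => resistanceDist G i j) x) y -
      Sum.elim (fun _ => 0) (fun z => if (Sum.inr z : TriVertex G q) = x then 1 else 0) y :=
    resistanceDist_triangulation hG q hrE
  simp only [hr, mul_sub, mul_add, Finset.sum_sub_distrib,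
    Finset.sum_add_distrib]
  rw [hT, hD, h1, h2, hA, hB, hwa, hwb, hsumh, hsumh]
  ring

open Classical in
theorem degree_triangulation {V : Type u} [Fintype V] (G : SimpleGraph V) (q : ℕ)
    [Fintype (TriVertex G q)] (x : TriVertex G q) :
    ((triangulation G q).degree x : ℝ) =
      Sum.elim (fun u => ((q : ℝ) + 1) * G.degree u) (fun _ => 2) x := by
  rw [degree_eq_sum, sum_triVertex]
  rcases x with u | ⟨e, a⟩
  · have h1 : ∀ (f : G.edgeSet) (b : Fin q),
        (triangulation G q).Adj (Sum.inl u) (Sum.inr (f, b)) ↔ u ∈ (f : Sym2 V) :=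
      fun _ _ => Iff.rfl
    have h2 : ∀ v : V, (triangulation G q).Adj (Sum.inl u) (Sum.inl v) ↔ G.Adj u v :=
      fun _ => Iff.rfl
    simp only [h1, h2, ← degree_eq_sum, Finset.sum_const, Finset.card_univ, Fintype.card_fin,
      nsmul_eq_mul, ← Finset.mul_sum, sum_mem_edge G (fun _ => 1), Sum.elim_inl]
    ring
  · have h1 : ∀ (f : G.edgeSet) (b : Fin q),
        ¬ (triangulation G q).Adj (Sum.inr (e, a)) (Sum.inr (f, b)) := fun _ _ h => h
    have h2 : ∀ u : V, (triangulation G q).Adj (Sum.inr (e, a)) (Sum.inl u) ↔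
        u ∈ (e : Sym2 V) := fun _ => Iff.rfl
    simp only [h1, h2, if_false, Finset.sum_const_zero, add_zero, Sum.elim_inr]
    rw [sum_ends_const]
    norm_num

theorem ncard_edgeSet_triangulation {V : Type u} [Fintype V] (G : SimpleGraph V) (q : ℕ) :
    ((triangulation G q).edgeSet.ncard : ℝ) = (2 * q + 1) * G.edgeSet.ncard := by
  classical
  have h := sum_degree_eq (triangulation G q)
  simp_rw [degree_triangulation] at h
  rw [sum_elim_triVertex, ← Finset.mul_sum, sum_degree_eq] at h
  linarith

theorem kirchhoffIndex_triangulation {V : Type u} [Fintype V] {G : SimpleGraph V}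
    (hG : G.Connected) (q : ℕ) [Fintype (TriVertex G q)] :
    kirchhoffIndex (triangulation G q) =
      2 / ((q : ℝ) + 2) * (kirchhoffIndex G + q / 2 * additiveDegreeKirchhoffIndex G +
        q ^ 2 / 4 * multiplicativeDegreeKirchhoffIndex G) +
      q * ((G.edgeSet.ncard : ℝ) / 2 - ((Fintype.card V : ℝ) - 1) / (2 * (q + 2))) *
        (Fintype.card V + q * G.edgeSet.ncard) - q * G.edgeSet.ncard / 2 := by
  classical
  have h := resistanceForm_triangulation hG q (fun _ => 1) (fun _ => 1) 1 1
  have he : (Sum.elim (fun _ => 1) fun _ => 1 : TriVertex G q → ℝ) = fun _ => 1 := by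
    ext (_ | _) <;> rfl
  have hw : (fun i => (1 : ℝ) + 1 * q * G.degree i / 2) =
      fun i => 1 + q / 2 * (G.degree i : ℝ) := by
    ext i
    ring
  rw [he, hw, resistanceForm_affine hG] at h
  rw [kirchhoffIndex_eq, h, kirchhoffIndex_eq, additiveDegreeKirchhoffIndex_eq hG,
    multiplicativeDegreeKirchhoffIndex_eq]
  simp only [Finset.sum_const, Finset.card_univ, nsmul_eq_mul]
  ring

theorem additiveDegreeKirchhoffIndex_triangulation {V : Type u} [Fintype V] {G : SimpleGraph V}
    (hG : G.Connected) (q : ℕ) [Fintype (TriVertex G q)] :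
    additiveDegreeKirchhoffIndex (triangulation G q) =
      2 / ((q : ℝ) + 2) * (2 * q + 1) * (additiveDegreeKirchhoffIndex G +
        q * multiplicativeDegreeKirchhoffIndex G) +
      q * ((G.edgeSet.ncard : ℝ) / 2 - ((Fintype.card V : ℝ) - 1) / (2 * (q + 2))) *
        (2 * (Fintype.card V + q * G.edgeSet.ncard) + 2 * (2 * q + 1) * G.edgeSet.ncard) -
      2 * q * G.edgeSet.ncard := by
  classical
  have h := resistanceForm_triangulation hG q (fun u => ((q : ℝ) + 1) * G.degree u)
    (fun _ => 1) 2 1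
  have he : (Sum.elim (fun _ => 1) fun _ => 1 : TriVertex G q → ℝ) = fun _ => 1 := by
    ext (_ | _) <;> rfl
  have hw : (fun i => (1 : ℝ) + 1 * q * G.degree i / 2) =
      fun i => 1 + q / 2 * (G.degree i : ℝ) := by
    ext i
    ring
  -- The degree weight pulls back to a multiple of the old degree, with no constant part. This makes
  -- the recursion triangular.
  have hw' : (fun i => ((q : ℝ) + 1) * G.degree i + 2 * q * G.degree i / 2) =
      fun i => 0 + (2 * q + 1) * (G.degree i : ℝ) := by
    ext i
    ring
  rw [he, hw, hw', resistanceForm_affine hG, ← Finset.mul_sum, sum_degree_eq] at h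
  rw [additiveDegreeKirchhoffIndex_eq (connected_triangulation hG q),
    funext (degree_triangulation G q), h, additiveDegreeKirchhoffIndex_eq hG,
    multiplicativeDegreeKirchhoffIndex_eq]
  simp only [Finset.sum_const, Finset.card_univ, nsmul_eq_mul]
  ring

theorem multiplicativeDegreeKirchhoffIndex_triangulation {V : Type u} [Fintype V] {G : SimpleGraph V}
    (hG : G.Connected) (q : ℕ) [Fintype (TriVertex G q)] :
    multiplicativeDegreeKirchhoffIndex (triangulation G q) =
      2 / ((q : ℝ) + 2) * (2 * q + 1) ^ 2 * multiplicativeDegreeKirchhoffIndex G +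
      4 * q * ((G.edgeSet.ncard : ℝ) / 2 - ((Fintype.card V : ℝ) - 1) / (2 * (q + 2))) *
        ((2 * q + 1) * G.edgeSet.ncard) - 2 * q * G.edgeSet.ncard := by
  classical
  have h := resistanceForm_triangulation hG q (fun u => ((q : ℝ) + 1) * G.degree u)
    (fun u => ((q : ℝ) + 1) * G.degree u) 2 2
  have hw' : (fun i => ((q : ℝ) + 1) * G.degree i + 2 * q * G.degree i / 2) =
      fun i => 0 + (2 * q + 1) * (G.degree i : ℝ) := by
    ext i
    ring
  rw [hw', resistanceForm_affine hG, ← Finset.mul_sum, sum_degree_eq] at h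
  rw [multiplicativeDegreeKirchhoffIndex_eq, funext (degree_triangulation G q), h,
    multiplicativeDegreeKirchhoffIndex_eq]
  ring

/-! ### Iteration -/

-- The definition adds the newest triangulation on the outside; splitting off the innermost one lets
-- the induction pass from `G` to `R_q(G)`.
open Classical in
theorem iteratedTri_succ {V : Type u} [Fintype V] (G : SimpleGraph V) (q k : ℕ) :
    iteratedTri G q (k + 1) = iteratedTri (triangulation G q) q k := by
  induction k with
  | zero => rfl
  | succ k ih => exact congrArg (FinGraph.tri q) ih

/-- The Kirchhoff index of the `k`-th iterated `q`-triangulation, in terms of the numbers `n`, `m`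
of vertices and edges of the graph and of its three Kirchhoff indices `K`, `A`, `M`. -/
noncomputable def closedForm (q : ℝ) (k : ℕ) (n m K A M : ℝ) : ℝ :=
  (2 / (q + 2)) ^ k * K
  + ((2 * (2 * q + 1) ^ 2 / (q + 2)) ^ k - (2 / (q + 2)) ^ k) *
    (M / 16 - m ^ 2 * (q + 2) / (12 * (2 * q + 1)) - m * n / 24
      + m * (q - 1) / (24 * (2 * q + 1)))
  + ((2 * (2 * q + 1) / (q + 2)) ^ k - (2 / (q + 2)) ^ k) *
    (A / 4 - M / 8 - m ^ 2 * (q + 2) * (2 * q - 1) / (6 * (2 * q + 1) * (2 * q + 5))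
      + m * (2 * n * (q - 1) - q + 4) / (12 * (2 * q + 1)) - n * (n - 1) / 12)
  + ((2 * q + 1) ^ (2 * k) - (2 / (q + 2)) ^ k) *
    (m ^ 2 * (2 * q + 3) ^ 2 / (8 * (2 * q + 1) * (2 * q + 5)))
  - ((2 * q + 1) ^ k - (2 / (q + 2)) ^ k) *
    (m * (4 * q ^ 2 + 12 * q + 11) * (m - 2 * n) / (12 * (2 * q + 1) * (2 * q + 5))
      + m * (4 * q ^ 2 + 18 * q + 23) / (12 * (2 * q + 1) * (2 * q + 5)))
  + ((2 / (q + 2)) ^ k - 1) * ((m - 2 * n) * (m - 2 * n + 2) / 24)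

/-- With the innermost step split off, the data of `R_q(G)` are fed into the same formula, so no
closed forms for the iterated degree-Kirchhoff indices are needed. -/
theorem closedForm_succ {q : ℝ} (hq : 0 ≤ q) (k : ℕ) (n m K A M : ℝ) :
    closedForm q (k + 1) n m K A M =
      closedForm q k (n + q * m) ((2 * q + 1) * m)
        (2 / (q + 2) * (K + q / 2 * A + q ^ 2 / 4 * M) +
          q * (m / 2 - (n - 1) / (2 * (q + 2))) * (n + q * m) - q * m / 2)
        (2 / (q + 2) * (2 * q + 1) * (A + q * M) +
          q * (m / 2 - (n - 1) / (2 * (q + 2))) * (2 * (n + q * m) + 2 * (2 * q + 1) * m) -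
          2 * q * m)
        (2 / (q + 2) * (2 * q + 1) ^ 2 * M +
          4 * q * (m / 2 - (n - 1) / (2 * (q + 2))) * ((2 * q + 1) * m) - 2 * q * m) := by
  have h1 : q + 2 ≠ 0 := by positivity
  have h2 : 2 * q + 1 ≠ 0 := by positivity
  have h3 : 2 * q + 5 ≠ 0 := by positivity
  unfold closedForm
  simp only [pow_succ _ k, show 2 * (k + 1) = 2 * k + 1 + 1 from rfl, pow_succ _ (2 * k + 1),
    pow_succ _ (2 * k)]
  -- Both sides are affine in the five `k`-th powers and agree coefficient by coefficient, so the
  -- powers may be treated as independent unknowns.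
  generalize (2 / (q + 2)) ^ k = x₁
  generalize (2 * (2 * q + 1) ^ 2 / (q + 2)) ^ k = x₂
  generalize (2 * (2 * q + 1) / (q + 2)) ^ k = x₃
  generalize (2 * q + 1) ^ (2 * k) = x₄
  generalize (2 * q + 1) ^ k = x₅
  field_simp
  ring

open Classical in
theorem kirchhoffIndex_iteratedTri {V : Type u} [Fintype V] {G : SimpleGraph V}
    (hG : G.Connected) (q k : ℕ) :
    (iteratedTri G q k).kirchhoffIndex =
      closedForm q k (Fintype.card V) G.edgeSet.ncard (kirchhoffIndex G)
        (additiveDegreeKirchhoffIndex G) (multiplicativeDegreeKirchhoffIndex G) := by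
  -- The induction hypothesis is applied to `triangulation G q`, which lives on another vertex type.
  induction k generalizing V with
  | zero =>
    simp only [closedForm, pow_zero, mul_zero, sub_self, zero_mul, add_zero, sub_zero, one_mul]
    rfl
  | succ k ih =>
    rw [iteratedTri_succ, ih (connected_triangulation hG q), closedForm_succ (Nat.cast_nonneg q),
      card_triVertex, ncard_edgeSet_triangulation, kirchhoffIndex_triangulation hG,
      additiveDegreeKirchhoffIndex_triangulation hG,
      multiplicativeDegreeKirchhoffIndex_triangulation hG, Nat.cast_add, Nat.cast_mul]

end QTriangulation


theorem theorem12 {V : Type u} [Fintype V] (G : SimpleGraph V) (hG : G.Connected)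
    (n m q k : ℕ) (hn : Fintype.card V = n) (hm : G.edgeSet.ncard = m) (hq : 0 < q) :
    (QTriangulation.iteratedTri G q k).kirchhoffIndex =
      (2 / ((q : ℝ) + 2)) ^ k * QTriangulation.kirchhoffIndex G
      + ((2 * (2 * (q : ℝ) + 1) ^ 2 / ((q : ℝ) + 2)) ^ k - (2 / ((q : ℝ) + 2)) ^ k) *
        (QTriangulation.multiplicativeDegreeKirchhoffIndex G / 16
          - (m : ℝ) ^ 2 * ((q : ℝ) + 2) / (12 * (2 * (q : ℝ) + 1))
          - (m : ℝ) * (n : ℝ) / 24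
          + (m : ℝ) * ((q : ℝ) - 1) / (24 * (2 * (q : ℝ) + 1)))
      + ((2 * (2 * (q : ℝ) + 1) / ((q : ℝ) + 2)) ^ k - (2 / ((q : ℝ) + 2)) ^ k) *
        (QTriangulation.additiveDegreeKirchhoffIndex G / 4
          - QTriangulation.multiplicativeDegreeKirchhoffIndex G / 8
          - (m : ℝ) ^ 2 * ((q : ℝ) + 2) * (2 * (q : ℝ) - 1)
            / (6 * (2 * (q : ℝ) + 1) * (2 * (q : ℝ) + 5))
          + (m : ℝ) * (2 * (n : ℝ) * ((q : ℝ) - 1) - (q : ℝ) + 4) / (12 * (2 * (q : ℝ) + 1))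
          - (n : ℝ) * ((n : ℝ) - 1) / 12)
      + ((2 * (q : ℝ) + 1) ^ (2 * k) - (2 / ((q : ℝ) + 2)) ^ k) *
        ((m : ℝ) ^ 2 * (2 * (q : ℝ) + 3) ^ 2 / (8 * (2 * (q : ℝ) + 1) * (2 * (q : ℝ) + 5)))
      - ((2 * (q : ℝ) + 1) ^ k - (2 / ((q : ℝ) + 2)) ^ k) *
        ((m : ℝ) * (4 * (q : ℝ) ^ 2 + 12 * (q : ℝ) + 11) * ((m : ℝ) - 2 * (n : ℝ))
            / (12 * (2 * (q : ℝ) + 1) * (2 * (q : ℝ) + 5))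
          + (m : ℝ) * (4 * (q : ℝ) ^ 2 + 18 * (q : ℝ) + 23)
            / (12 * (2 * (q : ℝ) + 1) * (2 * (q : ℝ) + 5)))
      + ((2 / ((q : ℝ) + 2)) ^ k - 1) *
        (((m : ℝ) - 2 * (n : ℝ)) * ((m : ℝ) - 2 * (n : ℝ) + 2) / 24) := by
  subst hn hm
  exact QTriangulation.kirchhoffIndex_iteratedTri hG q k
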